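/- Let $\alpha>1$, let $m(n)$ and $k_n$ be sequences of nonnegative integers with $m(n)\asymp n^{\alpha}$ (for instance $m(n)=\lfloor n^\alpha\rfloor$) and $k_n=o(n/\log n)$ as $n\to\infty$. For each $n$ let $\mathcal F_n$ be a collection of (possibly degenerate, not necessarily centred) multivariate normal distributions of $Z=(Y,X_1,\dots,X_{m(n)})\in\mathbb R^{1+m(n)}$, with uniformly bounded second moments: there is $C<\infty$ such that $E_FY^2\le C$ and $E_FX_j^2\le C$ for all $n$, all $F\in\mathcal F_n$ and all $1\le j\le m(n)$. For $\beta\in\mathbb R^{m(n)}$ let $L_F(\beta)=E_F\bigl(Y-\sum_j\beta_jX_j\bigr)^2$, and for observations $Z^i=(Y^i,X^i_1,\dots,X^i_{m(n)})$, $i=1,\dots,n$, let $L_{\hat F_n}(\beta)=\frac1n\sum_{i=1}^n\bigl(Y^i-\sum_j\beta_jX^i_j\bigr)^2$. Let $A(k_n)$ be the set of $\beta\in\mathbb R^{m(n)}$ with at most $k_n$ nonzero entries. Then $L_{\hat F_n}$ attains its minimum over $A(k_n)$ for every sample, $L_F$ attains its minimum over $A(k_n)$ for every $F\in\mathcal F_n$,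 at $\beta_F^*$ say, and best-subset empirical risk minimisation $$\hat\beta_n=\hat\beta_n(Z^1,\dots,Z^n)\in\arg\min_{\beta\in A(k_n)}L_{\hat F_n}(\beta)$$ (with any choice of minimisers) is persistent with respect to $A(k_n)$: for every $\varepsilon>0$, $$\sup_{F\in\mathcal F_n}P_F\bigl(L_F(\hat\beta_n)-L_F(\beta_F^*)>\varepsilon\bigr)\longrightarrow0\qquad(n\to\infty),$$ where under $P_F$ the observations $Z^1,\dots,Z^n$ are i.i.d. with distribution $F$ (and $P_F$ is the outer probability if the choice of minimisers is not measurable). -/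

import Mathlib

open MeasureTheory ProbabilityTheory Filter Topology Asymptotics
open scoped ENNReal

noncomputable section

namespace Persistence

/-- `b` is a minimizer of `L` over the set `B`, i.e. `b ∈ arg min_{β ∈ B} L β`. -/
def IsArgMin {P : Type*} (L : P → ℝ) (B : Set P) (b : P) : Prop :=
  b ∈ B ∧ ∀ β ∈ B, L b ≤ L β

/-- The risk `L_F(β) = E_F l(β, Z)`, where `Z ∼ F`. -/
def risk {P Z : Type*} [MeasurableSpace Z] (l : P → Z → ℝ) (F : Measure Z) (β : P) : ℝ :=
  ∫ z, l β z ∂F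

/-- The empirical risk `n⁻¹ ∑ l(β, Zⁱ)`, i.e. the risk under the empirical distribution of the
observations `Z¹, …, Zⁿ`. -/
def empiricalRisk {P Z : Type*} (l : P → Z → ℝ) {n : ℕ} (z : Fin n → Z) (β : P) : ℝ :=
  (∑ i, l β (z i)) / n

/-- Persistence of a sequence of procedures `βhat n = βhat n (Z¹, …, Zⁿ)` with values in `B n`,
for a triangular array with loss `l n` and collections of distributions `𝓕 n`. The best predictors
`βstar n F = arg min_{β ∈ B n} L_F(β)` exist for all `F ∈ 𝓕 n`, and for every `ε > 0` the supremum
over `F ∈ 𝓕 n` of `P_F (L_F(βhat n) - L_F(βstar n F) > ε)` tends to `0`, where `P_F` is the law of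
`n` independent observations from `F`. (For a procedure that is not measurable, `P_F` is the outer
probability.) -/
def IsPersistent {P Z : ℕ → Type*} [∀ n, MeasurableSpace (Z n)] (l : ∀ n, P n → Z n → ℝ)
    (𝓕 : ∀ n, Set (Measure (Z n))) (B : ∀ n, Set (P n)) (βhat : ∀ n, (Fin n → Z n) → P n) : Prop :=
  (∀ n z, βhat n z ∈ B n) ∧
  (∀ n, ∀ F ∈ 𝓕 n, ∃ b, IsArgMin (risk (l n) F) (B n) b) ∧
  ∀ βstar : ∀ n, Measure (Z n) → P n,
    (∀ n, ∀ F ∈ 𝓕 n, IsArgMin (risk (l n) F) (B n) (βstar n F)) →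
    ∀ ε : ℝ, 0 < ε →
      Tendsto
        (fun n => ⨆ F ∈ 𝓕 n, Measure.pi (fun _ : Fin n => F)
          {z | ε < risk (l n) F (βhat n z) - risk (l n) F (βstar n F)})
        atTop (𝓝 (0 : ℝ≥0∞))

/-- An observation `(Y, X) = (Y, (X_1, …, X_m))`. -/
abbrev Obs (m : ℕ) : Type := ℝ × (Fin m → ℝ)

/-- The squared prediction loss `(Y - ∑ j, β_j X_j)²` of the linear predictor `β`. -/
def squaredLoss (m : ℕ) (β : Fin m → ℝ) (z : Obs m) : ℝ :=
  (z.1 - ∑ j, β j * z.2 j) ^ 2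

/-- `A(k)`: the linear predictors with at most `k` active (nonzero) entries. -/
def sparse (m k : ℕ) : Set (Fin m → ℝ) :=
  {β | (Finset.univ.filter fun j => β j ≠ 0).card ≤ k}

end Persistence

end

/-! The residual of a `k`-sparse predictor is a linear functional of a Gaussian vector lying in the
span of `Y` and at most `k` covariates, a space of dimension at most `k + 1`. For one functional,
the empirical second moment deviates from the true one by more than a fraction `δ` with probability
at most `2 exp (-c n)`, where `c` depends only on `δ`
(`exists_forall_isGaussian_measure_abs_sum_sq_sub_le`).

A relative bound on at most `6 ^ (k + 1)` test vectors extends to the whole span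
(`exists_test_finset`). With at most `(m + 1) ^ k` spans, the union bound tends to zero because `k
log m = o(n)`.

As the error is relative to the risk, no bound on the coefficients is needed: the excess risk is at
most `4 δ` times the minimal risk, which is at most the risk `E Y²` of the zero predictor. -/

namespace Persistence

/-! ### Nets and finite test sets for quadratic forms -/

/-- The sphere of radius `2` has a net of mesh `1` with at most `5 ^ dim` points. -/
theorem exists_finset_net_sphere (R : Type*) [NormedAddCommGroup R] [InnerProductSpace ℝ R]
    [FiniteDimensional ℝ R] :
    ∃ s : Finset R, s.card ≤ 5 ^ Module.finrank ℝ R ∧ (∀ c ∈ s, ‖c‖ = 2) ∧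
      ∀ x : R, ‖x‖ = 2 → ∃ c ∈ s, ‖x - c‖ < 1 := by
  classical
  let P : ℕ → Prop := fun k => ∃ s : Finset R, s.card = k ∧ (∀ c ∈ s, ‖c‖ = 2) ∧
    ∀ c ∈ s, ∀ d ∈ s, c ≠ d → 1 ≤ ‖c - d‖
  have hb : ∀ k, P k → k ≤ 5 ^ Module.finrank ℝ R := by
    rintro k ⟨s, rfl, h2, hs⟩
    exact Besicovitch.card_le_of_separated s (fun c hc => (h2 c hc).le) hs
  have h0 : P 0 := ⟨∅, by simp⟩
  -- A 1-separated set of maximal cardinality is a net, since a point far from it could be added.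
  obtain ⟨s, hcard, h2, hs⟩ := Nat.findGreatest_spec (P := P) (Nat.zero_le _) h0
  refine ⟨s, hcard ▸ Nat.findGreatest_le _, h2, fun x hx => ?_⟩
  by_contra! hfar
  have hxs : x ∉ s := fun h => by have := hfar x h; simp at this; linarith
  have hP : P (s.card + 1) := by
    refine ⟨insert x s, Finset.card_insert_of_notMem hxs, ?_, ?_⟩
    · intro c hc
      rcases Finset.mem_insert.1 hc with rfl | hc
      exacts [hx, h2 c hc]
    · intro c hc d hd hcd
      rcases Finset.mem_insert.1 hc with h | h <;> rcases Finset.mem_insert.1 hd with h' | h'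
      · exact absurd (h.trans h'.symm) hcd
      · exact h ▸ hfar d h'
      · rw [norm_sub_rev]; exact h' ▸ hfar c h
      · exact hs c h d h' hcd
  have := Nat.le_findGreatest (hb _ hP) hP
  omega

/-- A quadratic form that is compared with the squared norm on a net is comparable everywhere. -/
theorem abs_normSq_sub_le_of_net {R H : Type*} [NormedAddCommGroup R] [InnerProductSpace ℝ R]
    [FiniteDimensional ℝ R] [NormedAddCommGroup H] [InnerProductSpace ℝ H] (Ψ : R →ₗ[ℝ] H)
    (s : Set R) (h2 : ∀ c ∈ s, ‖c‖ = 2) (hnet : ∀ x : R, ‖x‖ = 2 → ∃ c ∈ s, ‖x - c‖ < 1)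
    {η : ℝ} (hη : ∀ c ∈ s, |‖Ψ c‖ ^ 2 - ‖c‖ ^ 2| ≤ η * ‖c‖ ^ 2) (x : R) :
    |‖Ψ x‖ ^ 2 - ‖x‖ ^ 2| ≤ 32 * η * ‖x‖ ^ 2 := by
  by_cases hx : x = 0
  · simp [hx]
  set D : R → ℝ := fun x => ‖Ψ x‖ ^ 2 - ‖x‖ ^ 2 with hD
  have hsmul : ∀ (a : ℝ) y, D (a • y) = a ^ 2 * D y := fun a y => by
    simp only [hD, map_smul, norm_smul, mul_pow, Real.norm_eq_abs, sq_abs]; ring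
  have hscale : ∀ y : R, y ≠ 0 →
      ‖(2 / ‖y‖) • y‖ = 2 ∧ D ((2 / ‖y‖) • y) = 4 / ‖y‖ ^ 2 * D y := fun y hy => by
    have := norm_pos_iff.2 hy
    refine ⟨?_, by rw [hsmul]; ring⟩
    rw [norm_smul, Real.norm_of_nonneg (by positivity)]; field_simp
  have hcont : Continuous D := by
    have : Continuous Ψ := Ψ.continuous_of_finiteDimensional
    fun_prop
  obtain ⟨u, hu, hmax⟩ := (isCompact_sphere (0 : R) 2).exists_isMaxOn
    ⟨(2 / ‖x‖) • x, by simp [(hscale x hx).1]⟩ hcont.abs.continuousOn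
  have hu2 : ‖u‖ = 2 := by simpa using hu
  have hM : ∀ y, |D y| ≤ |D u| / 4 * ‖y‖ ^ 2 := fun y => by
    by_cases hy : y = 0
    · simp [hy, hD]
    have hpos := norm_pos_iff.2 hy
    have h := hmax (a := (2 / ‖y‖) • y) (by simp [(hscale y hy).1])
    simp only [Set.mem_ofPred_eq] at h
    rw [(hscale y hy).2, abs_mul, abs_of_pos (by positivity), div_mul_eq_mul_div,
      div_le_iff₀ (by positivity)] at h
    linarith
  obtain ⟨v, hv, huv⟩ := hnet u hu2
  have hv2 := h2 v hv
  -- Polarization: the two vectors are `2(u - v) ± (u + v)/2`. The weights balance `‖u - v‖ < 1`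
  -- against `‖u + v‖ ≤ 4`, so both squared norms are at most `31/4`. This is below 8, so the
  -- maximum `|D u|` can be absorbed on the left, at the price of the factor 32.
  have hpol : 4 * (D u - D v) =
      D ((5 / 2 : ℝ) • u - (3 / 2 : ℝ) • v) - D ((3 / 2 : ℝ) • u - (5 / 2 : ℝ) • v) := by
    simp only [hD, map_sub, map_smul, norm_sub_sq_real, norm_smul, inner_smul_left,
      inner_smul_right, mul_pow, Real.norm_eq_abs, sq_abs]
    simp; ring
  have h1 := hM ((5 / 2 : ℝ) • u - (3 / 2 : ℝ) • v)
  have h3 := hM ((3 / 2 : ℝ) • u - (5 / 2 : ℝ) • v)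
  have hin : 7 / 2 ≤ inner ℝ u v := by
    have h := norm_sub_sq_real u v
    have : ‖u - v‖ ^ 2 ≤ 1 := by nlinarith [norm_nonneg (u - v)]
    rw [hu2, hv2] at h; linarith
  have e1 : ‖(5 / 2 : ℝ) • u - (3 / 2 : ℝ) • v‖ ^ 2 ≤ 31 / 4 := by
    simp only [norm_sub_sq_real, norm_smul, inner_smul_left, inner_smul_right, hu2, hv2]
    norm_num; linarith
  have e3 : ‖(3 / 2 : ℝ) • u - (5 / 2 : ℝ) • v‖ ^ 2 ≤ 31 / 4 := by
    simp only [norm_sub_sq_real, norm_smul, inner_smul_left, inner_smul_right, hu2, hv2]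
    norm_num; linarith
  have hDv : |D v| ≤ η * 4 := by
    have h : |D v| ≤ η * ‖v‖ ^ 2 := hη v hv
    rw [hv2] at h; linarith
  have hM0 : 0 ≤ |D u| / 4 := by positivity
  have h1' := h1.trans (mul_le_mul_of_nonneg_left e1 hM0)
  have h3' := h3.trans (mul_le_mul_of_nonneg_left e3 hM0)
  have hDu : |D u| ≤ |D v| + 31 / 32 * |D u| := by
    have hsum : |4 * (D u - D v)| ≤ |D u| / 4 * (31 / 4) + |D u| / 4 * (31 / 4) := by
      rw [hpol]; exact (abs_sub _ _).trans (add_le_add h1' h3')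
    rw [abs_mul, abs_of_pos (by norm_num : (0 : ℝ) < 4)] at hsum
    have := abs_sub_abs_le_abs_sub (D u) (D v)
    linarith
  refine (hM x).trans (mul_le_mul_of_nonneg_right ?_ (by positivity))
  linarith

/-- A finite-dimensional space `V` with a seminorm `‖T ·‖` has a test set of at most `6 ^ dim V`
vectors that controls the comparison of any other Hilbertian seminorm with `‖T ·‖`. -/
theorem exists_test_finset {E H : Type*} [AddCommGroup E] [Module ℝ E] [NormedAddCommGroup H]
    [InnerProductSpace ℝ H] (V : Submodule ℝ E) [FiniteDimensional ℝ V] (T : E →ₗ[ℝ] H) :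
    ∃ N : Finset E, N.card ≤ 6 ^ Module.finrank ℝ V ∧
      ∀ {G : Type} [NormedAddCommGroup G] [InnerProductSpace ℝ G] (Φ : E →ₗ[ℝ] G) (η : ℝ),
        (∀ v ∈ N, |‖Φ v‖ ^ 2 - ‖T v‖ ^ 2| ≤ η * ‖T v‖ ^ 2) →
        ∀ v ∈ V, |‖Φ v‖ ^ 2 - ‖T v‖ ^ 2| ≤ 32 * η * ‖T v‖ ^ 2 := by
  classical
  let S : V →ₗ[ℝ] H := T ∘ₗ V.subtype
  obtain ⟨s, hcard, h2, hnet⟩ := exists_finset_net_sphere (LinearMap.range S)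
  obtain ⟨lift, hlift⟩ := S.rangeRestrict.exists_rightInverse_of_surjective S.range_rangeRestrict
  have hlift' : ∀ r, S.rangeRestrict (lift r) = r := fun r => LinearMap.congr_fun hlift r
  -- On the kernel of `S` the tolerance is zero, so testing a basis forces `Φ` to vanish there and
  -- to factor through the range. This handles degenerate distributions.
  let b := Module.finBasis ℝ (LinearMap.ker S)
  refine ⟨s.image (fun r => (lift r : E)) ∪ Finset.univ.image (fun i => ((b i : V) : E)), ?_, ?_⟩
  · have hk : Module.finrank ℝ (LinearMap.ker S) ≤ Module.finrank ℝ V := Submodule.finrank_le _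
    have hr : Module.finrank ℝ (LinearMap.range S) ≤ Module.finrank ℝ V :=
      LinearMap.finrank_range_le S
    have hpow : ∀ d : ℕ, 5 ^ d + d ≤ 6 ^ d := fun d => by
      induction d with
      | zero => simp
      | succ d ih =>
        have := Nat.one_le_pow d 5 (by norm_num)
        rw [pow_succ, pow_succ]; omega
    calc _ ≤ s.card + (Finset.univ : Finset (Fin _)).card :=
          (Finset.card_union_le _ _).trans (add_le_add Finset.card_image_le Finset.card_image_le)
      _ ≤ 5 ^ Module.finrank ℝ V + Module.finrank ℝ V := by
          rw [Finset.card_univ, Fintype.card_fin]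
          exact add_le_add (hcard.trans (Nat.pow_le_pow_right (by norm_num) hr)) hk
      _ ≤ _ := hpow _
  · intro G _ _ Φ η hN v hv
    have hker : ∀ w : V, S w = 0 → Φ w = 0 := by
      intro w hw
      have hb : (Φ ∘ₗ V.subtype) ∘ₗ (LinearMap.ker S).subtype = 0 := by
        refine b.ext fun i => ?_
        have h := hN (b i : V) (Finset.mem_union_right _ (Finset.mem_image_of_mem _
          (Finset.mem_univ i)))
        have h0 : T ((b i : V) : E) = 0 := (b i).2
        simpa [h0] using h
      exact LinearMap.congr_fun hb ⟨w, hw⟩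
    let Ψ : LinearMap.range S →ₗ[ℝ] G := (Φ ∘ₗ V.subtype) ∘ₗ lift
    have hΨ : ∀ w : V, Ψ (S.rangeRestrict w) = Φ w := fun w => by
      have h0 : S (lift (S.rangeRestrict w) - w) = 0 := by
        have := congrArg Subtype.val (hlift' (S.rangeRestrict w))
        rw [map_sub, sub_eq_zero]; exact this
      have := hker _ h0
      rw [Submodule.coe_sub, map_sub, sub_eq_zero] at this
      exact this
    have hn : ∀ w : V, ‖S.rangeRestrict w‖ = ‖T w‖ := fun w => rfl
    have key := abs_normSq_sub_le_of_net Ψ s h2 hnet (η := η) (fun c hc => by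
      have h := hN (lift c) (Finset.mem_union_left _ (Finset.mem_image_of_mem _ hc))
      rwa [← hΨ, ← hn, hlift'] at h) (S.rangeRestrict ⟨v, hv⟩)
    rwa [hΨ, hn] at key

end Persistence

/-! ### Gaussian concentration of empirical second moments -/

namespace Persistence

/-- Second-order Taylor remainder. For a centred variable the linear term integrates to zero, which
leaves a moment generating function bound quadratic in `t`. -/
theorem exp_le_one_add_add_sq_mul_exp_abs (x : ℝ) :
    Real.exp x ≤ 1 + x + x ^ 2 * Real.exp |x| := by
  have h := Complex.norm_exp_sub_sum_le_norm_mul_exp (x : ℂ) 2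
  simp only [Finset.sum_range_succ, Finset.sum_range_zero] at h
  have e : Complex.exp x - (0 + (x : ℂ) ^ 0 / (Nat.factorial 0 : ℕ) + (x : ℂ) ^ 1 /
      (Nat.factorial 1 : ℕ)) = ((Real.exp x - (1 + x) : ℝ) : ℂ) := by
    push_cast; simp
  rw [e, Complex.norm_real, Complex.norm_real, Real.norm_eq_abs, Real.norm_eq_abs, sq_abs] at h
  linarith [le_abs_self (Real.exp x - (1 + x))]

theorem integrable_exp_sq_div_four_gaussianReal :
    Integrable (fun x : ℝ => Real.exp (x ^ 2 / 4)) (gaussianReal 0 1) := by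
  rw [gaussianReal_of_var_ne_zero _ one_ne_zero, gaussianPDF_def]
  rw [integrable_withDensity_iff_integrable_smul₀' (by fun_prop) (by simp)]
  have h : Integrable fun x : ℝ => (√(2 * Real.pi))⁻¹ * Real.exp (-(1 / 4) * x ^ 2) :=
    (integrable_exp_neg_mul_sq (by norm_num)).const_mul _
  refine h.congr (Eventually.of_forall fun x => ?_)
  simp only [smul_eq_mul]
  rw [ENNReal.toReal_ofReal (gaussianPDFReal_nonneg _ _ _), gaussianPDFReal, mul_assoc,
    ← Real.exp_add]
  simp only [NNReal.coe_one, mul_one, sub_zero]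
  congr 2; ring

/-- Gaussian variables with second moment at most `1` have a uniform squared exponential moment. -/
theorem integral_exp_sq_div_eight_gaussianReal_le {μ : ℝ} {v : NNReal} (h : μ ^ 2 + v ≤ 1) :
    Integrable (fun x : ℝ => Real.exp (x ^ 2 / 8)) (gaussianReal μ v) ∧
    ∫ x, Real.exp (x ^ 2 / 8) ∂(gaussianReal μ v) ≤
      ∫ x, Real.exp (1 / 4) * Real.exp (x ^ 2 / 4) ∂(gaussianReal 0 1) := by
  have hmap : gaussianReal μ v = (gaussianReal 0 1).map (fun x => √v * x + μ) := by
    have : (fun x : ℝ => √v * x + μ) = (fun x => x + μ) ∘ (fun x => √v * x) := rfl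
    rw [this, ← Measure.map_map (by fun_prop) (by fun_prop), gaussianReal_map_const_mul,
      gaussianReal_map_add_const]
    congr 1
    · simp
    · ext; simp
  -- From `(a + b)² ≤ 2a² + 2b²` with `v ≤ 1` and `μ² ≤ 1`.
  have hle : ∀ x : ℝ, Real.exp ((√v * x + μ) ^ 2 / 8) ≤
      Real.exp (1 / 4) * Real.exp (x ^ 2 / 4) := fun x => by
    rw [← Real.exp_add, Real.exp_le_exp]
    have hs : √(v : ℝ) ^ 2 = v := Real.sq_sqrt v.2
    have hv1 : (v : ℝ) ≤ 1 := by nlinarith [sq_nonneg μ]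
    have hm1 : μ ^ 2 ≤ 1 := by linarith [v.2]
    have h3 : (√v * x) ^ 2 ≤ x ^ 2 := by
      rw [mul_pow, hs]; nlinarith [sq_nonneg x]
    nlinarith [sq_nonneg (√v * x - μ)]
  have hint : Integrable (fun x : ℝ => Real.exp ((√v * x + μ) ^ 2 / 8)) (gaussianReal 0 1) := by
    refine (integrable_exp_sq_div_four_gaussianReal.const_mul (Real.exp (1 / 4))).mono'
      (by fun_prop) (Eventually.of_forall fun x => ?_)
    rw [Real.norm_of_nonneg (Real.exp_nonneg _)]
    exact hle x
  rw [hmap]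
  constructor
  · rw [integrable_map_measure (by fun_prop) (by fun_prop)]
    exact hint
  · rw [integral_map (by fun_prop) (by fun_prop)]
    exact integral_mono hint (integrable_exp_sq_div_four_gaussianReal.const_mul _) hle

/-- A uniform bound on the moment generating function of the centred square of a Gaussian variable
with second moment `1`. -/
theorem exists_mgf_sq_sub_one_le : ∃ K : ℝ, 0 < K ∧ ∀ (μ : ℝ) (v : NNReal), μ ^ 2 + v = 1 →
    ∀ t : ℝ, |t| ≤ 1 / 16 →
      Integrable (fun x : ℝ => Real.exp (t * (x ^ 2 - 1))) (gaussianReal μ v) ∧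
      ∫ x, Real.exp (t * (x ^ 2 - 1)) ∂(gaussianReal μ v) ≤ Real.exp (K * t ^ 2) := by
  set J := ∫ x, Real.exp (1 / 4) * Real.exp (x ^ 2 / 4) ∂(gaussianReal 0 1) with hJ
  have hJ0 : 0 ≤ J := integral_nonneg fun x => by positivity
  set c := 512 * Real.exp (1 / 8) with hc
  have hc0 : 0 < c := by positivity
  refine ⟨c * J + 1, by positivity, fun μ v h t ht => ?_⟩
  obtain ⟨hi, hiJ⟩ := integral_exp_sq_div_eight_gaussianReal_le h.le
  have hsq : Integrable (fun x : ℝ => x ^ 2) (gaussianReal μ v) :=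
    (memLp_id_gaussianReal 2).integrable_sq
  have hmean : ∫ x, (x ^ 2 - 1) ∂(gaussianReal μ v) = 0 := by
    have hvar := variance_eq_sub (memLp_id_gaussianReal (μ := μ) (v := v) 2)
    rw [variance_id_gaussianReal] at hvar
    simp only [id, Pi.pow_apply, integral_id_gaussianReal] at hvar
    rw [integral_sub hsq (integrable_const _)]
    simp; linarith
  -- One factor `exp (a / 16)` absorbs `a²` and another bounds the remainder exponential, as `|t| ≤
  -- 1/16`; their product is at most `exp (1/8) * exp (x² / 8)`.
  have hpt : ∀ x : ℝ, Real.exp (t * (x ^ 2 - 1)) ≤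
      1 + t * (x ^ 2 - 1) + t ^ 2 * c * Real.exp (x ^ 2 / 8) := fun x => by
    refine (exp_le_one_add_add_sq_mul_exp_abs _).trans ?_
    set a := |x ^ 2 - 1| with ha
    have ha0 : 0 ≤ a := abs_nonneg _
    have hax : a ≤ x ^ 2 + 1 := abs_le.2 ⟨by nlinarith [sq_nonneg x], by linarith⟩
    have e1 : a ^ 2 ≤ 512 * Real.exp (a / 16) := by
      have := Real.quadratic_le_exp_of_nonneg (x := a / 16) (by positivity)
      nlinarith
    have e2 : Real.exp |t * (x ^ 2 - 1)| ≤ Real.exp (a / 16) := by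
      rw [Real.exp_le_exp, abs_mul]; nlinarith
    have e3 : Real.exp (a / 16) * Real.exp (a / 16) ≤ Real.exp (1 / 8) * Real.exp (x ^ 2 / 8) := by
      rw [← Real.exp_add, ← Real.exp_add, Real.exp_le_exp]; linarith
    have e4 : (t * (x ^ 2 - 1)) ^ 2 = t ^ 2 * a ^ 2 := by rw [mul_pow, ha, sq_abs]
    rw [e4]
    have : t ^ 2 * a ^ 2 * Real.exp |t * (x ^ 2 - 1)| ≤ t ^ 2 * c * Real.exp (x ^ 2 / 8) := by
      calc _ ≤ t ^ 2 * (512 * Real.exp (a / 16)) * Real.exp (a / 16) := by gcongr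
        _ = t ^ 2 * 512 * (Real.exp (a / 16) * Real.exp (a / 16)) := by ring
        _ ≤ t ^ 2 * 512 * (Real.exp (1 / 8) * Real.exp (x ^ 2 / 8)) := by gcongr
        _ = _ := by rw [hc]; ring
    linarith
  have hlin : Integrable (fun x : ℝ => 1 + t * (x ^ 2 - 1)) (gaussianReal μ v) :=
    (integrable_const _).add ((hsq.sub (integrable_const _)).const_mul t)
  have hdom : Integrable (fun x : ℝ => 1 + t * (x ^ 2 - 1) + t ^ 2 * c * Real.exp (x ^ 2 / 8))
      (gaussianReal μ v) := hlin.add (hi.const_mul _)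
  have hint : Integrable (fun x : ℝ => Real.exp (t * (x ^ 2 - 1))) (gaussianReal μ v) := by
    refine hdom.mono' (by fun_prop) (Eventually.of_forall fun x => ?_)
    rw [Real.norm_of_nonneg (Real.exp_nonneg _)]
    exact hpt x
  refine ⟨hint, (integral_mono hint hdom hpt).trans ?_⟩
  have hlin' : Integrable (fun x : ℝ => t * (x ^ 2 - 1)) (gaussianReal μ v) :=
    (hsq.sub (integrable_const _)).const_mul t
  rw [integral_add hlin (hi.const_mul _), integral_add (integrable_const _) hlin',
    integral_const_mul, hmean, integral_const_mul]
  simp only [integral_const, probReal_univ, smul_eq_mul, mul_zero, add_zero, mul_one]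
  have h1 : t ^ 2 * c * ∫ x, Real.exp (x ^ 2 / 8) ∂(gaussianReal μ v) ≤ t ^ 2 * c * J := by gcongr
  have h2 := Real.add_one_le_exp ((c * J + 1) * t ^ 2)
  nlinarith [sq_nonneg t]

/-- Chernoff's bound for the sum of a function of i.i.d. observations. -/
theorem measureReal_pi_le_sum_le {Z : Type*} [MeasurableSpace Z] (F : Measure Z)
    [IsProbabilityMeasure F] {U : Z → ℝ} (hU : Measurable U) {t r : ℝ} (ht : 0 ≤ t)
    (hint : Integrable (fun z => Real.exp (t * U z)) F)
    (hr : ∫ z, Real.exp (t * U z) ∂F ≤ Real.exp r) (n : ℕ) (a : ℝ) :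
    (Measure.pi fun _ : Fin n => F).real {z | a ≤ ∑ i, U (z i)} ≤
      Real.exp (-t * a + n * r) := by
  have hind : iIndepFun (fun (i : Fin n) (z : Fin n → Z) => U (z i))
      (Measure.pi fun _ : Fin n => F) := iIndepFun_pi fun _ => hU.aemeasurable
  have hmeas : ∀ i : Fin n, Measurable fun z : Fin n → Z => U (z i) := fun i => by fun_prop
  have hmp : ∀ i : Fin n, MeasurePreserving (Function.eval i)
      (Measure.pi fun _ : Fin n => F) F := fun i => measurePreserving_eval _ i
  have hinti : ∀ i ∈ (Finset.univ : Finset (Fin n)), Integrable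
      (fun z : Fin n → Z => Real.exp (t * U (z i))) (Measure.pi fun _ : Fin n => F) :=
    fun i _ => (hmp i).integrable_comp_of_integrable hint
  have h := measure_ge_le_exp_mul_mgf a ht (hind.integrable_exp_mul_sum hmeas hinti)
  rw [hind.mgf_sum hmeas] at h
  simp only [Finset.sum_apply] at h
  refine h.trans ?_
  rw [Real.exp_add]
  gcongr
  have hm : ∀ i : Fin n, mgf (fun z : Fin n → Z => U (z i)) (Measure.pi fun _ : Fin n => F) t ≤
      Real.exp r := fun i => by
    rw [mgf]
    have e := integral_map (μ := Measure.pi fun _ : Fin n => F) (hmp i).measurable.aemeasurable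
      (f := fun z => Real.exp (t * U z)) (by fun_prop)
    rw [(hmp i).map_eq] at e
    exact e ▸ hr
  refine (Finset.prod_le_prod (fun i _ => mgf_nonneg) fun i _ => hm i).trans ?_
  simp [Real.exp_nat_mul]

/-- The empirical second moments of the linear functionals of a Gaussian vector concentrate around
the theoretical ones, relative to their size and at a rate that depends on nothing else. -/
theorem exists_forall_isGaussian_measure_abs_sum_sq_sub_le {δ : ℝ} (hδ : 0 < δ) :
    ∃ c : ℝ, 0 < c ∧ ∀ {E : Type} [NormedAddCommGroup E] [NormedSpace ℝ E] [MeasurableSpace E]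
      [BorelSpace E] (F : Measure E) [IsGaussian F] (L : StrongDual ℝ E) (n : ℕ), 0 < n →
      (Measure.pi fun _ : Fin n => F)
        {z | ¬ |(∑ i, L (z i) ^ 2) / n - ∫ x, L x ^ 2 ∂F| ≤ δ * ∫ x, L x ^ 2 ∂F} ≤
      ENNReal.ofReal (2 * Real.exp (-c * n)) := by
  obtain ⟨K, hK, hmgf⟩ := exists_mgf_sq_sub_one_le
  -- This makes the quadratic cost `K t²` at most half of the Chernoff gain `t δ`.
  set t := min (1 / 16) (δ / (2 * K)) with ht
  have ht0 : 0 < t := by positivity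
  have ht1 : t ≤ 1 / 16 := min_le_left _ _
  have ht2 : K * t ^ 2 ≤ t * δ / 2 := by
    have : t ≤ δ / (2 * K) := min_le_right _ _
    rw [le_div_iff₀ (by positivity)] at this
    nlinarith
  refine ⟨t * δ / 2, by positivity, fun {E} _ _ _ _ F _ L n hn => ?_⟩
  have hLp : MemLp L 2 F := IsGaussian.memLp_dual F L 2 (by simp)
  set Q := ∫ x, L x ^ 2 ∂F with hQ
  have hQ0 : 0 ≤ Q := integral_nonneg fun x => sq_nonneg _
  have hn0 : (0 : ℝ) < n := by exact_mod_cast hn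
  have hmp : ∀ i : Fin n, MeasurePreserving (Function.eval i)
      (Measure.pi fun _ : Fin n => F) F := fun i => measurePreserving_eval _ i
  rcases hQ0.eq_or_lt with hz | hpos
  · have hae : ∀ᵐ x ∂F, L x = 0 := by
      have := (integral_eq_zero_iff_of_nonneg (fun x => sq_nonneg (L x)) hLp.integrable_sq).1 hz.symm
      filter_upwards [this] with x hx
      simpa using hx
    have hall : ∀ᵐ z ∂(Measure.pi fun _ : Fin n => F), ∀ i, L (z i) = 0 :=
      ae_all_iff.2 fun i => (hmp i).quasiMeasurePreserving.ae hae
    refine le_of_eq_of_le ?_ zero_le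
    rw [← ae_iff]
    filter_upwards [hall] with z hz'
    simp [hz', ← hz]
  · set U : E → ℝ := fun x => L x ^ 2 / Q - 1 with hU
    have hUm : Measurable U := by have := L.continuous.measurable; fun_prop
    -- Dividing by `√Q` gives a Gaussian variable with second moment 1, so the rate is free of `F`
    -- and `L`.
    set μ : ℝ := (√Q)⁻¹ * F[L] with hμ
    have hs : √Q ^ 2 = Q := Real.sq_sqrt hQ0
    have hs0 : 0 < √Q := Real.sqrt_pos.2 hpos
    obtain ⟨v, hv1, hmap⟩ : ∃ v : NNReal, μ ^ 2 + v = 1 ∧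
        F.map (fun x => (√Q)⁻¹ * L x) = gaussianReal μ v := by
      refine ⟨NNReal.mk ((√Q)⁻¹ ^ 2) (sq_nonneg _) * Var[L; F].toNNReal, ?_, ?_⟩
      rotate_left
      · have : (fun x => (√Q)⁻¹ * L x) = (fun y => (√Q)⁻¹ * y) ∘ L := rfl
        rw [this, ← Measure.map_map (by fun_prop) L.continuous.measurable,
          IsGaussian.map_eq_gaussianReal L, gaussianReal_map_const_mul]
      · have hvar := variance_eq_sub hLp
        have hvn := variance_nonneg L F
        simp only [NNReal.coe_mul, NNReal.coe_mk, Real.coe_toNNReal _ hvn, hμ]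
        rw [hvar]
        simp only [Pi.pow_apply]
        rw [← hQ, inv_pow, mul_pow, inv_pow, hs]
        field_simp; ring
    have hUe : ∀ s : ℝ, (fun x => Real.exp (s * U x)) =
        (fun y => Real.exp (s * (y ^ 2 - 1))) ∘ fun x => (√Q)⁻¹ * L x := fun s => by
      funext x
      simp only [hU, Function.comp, mul_pow, inv_pow, hs]
      congr 2; ring
    have hLm : Measurable L := L.continuous.measurable
    have hb : ∀ s : ℝ, |s| ≤ 1 / 16 → Integrable (fun x => Real.exp (s * U x)) F ∧
        ∫ x, Real.exp (s * U x) ∂F ≤ Real.exp (K * s ^ 2) := fun s hs' => by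
      obtain ⟨h1, h2⟩ := hmgf μ v hv1 s hs'
      rw [← hmap] at h1 h2
      rw [integrable_map_measure (by fun_prop) (by fun_prop)] at h1
      rw [integral_map (by fun_prop) (by fun_prop)] at h2
      refine ⟨by rw [hUe]; exact h1, le_of_eq_of_le ?_ h2⟩
      exact congrArg (fun f => ∫ x, f x ∂F) (hUe s)
    obtain ⟨hp1, hp2⟩ := hb t (by rwa [abs_of_pos ht0])
    obtain ⟨hm1, hm2⟩ := hb (-t) (by rwa [abs_neg, abs_of_pos ht0])
    have hp := measureReal_pi_le_sum_le F hUm ht0.le hp1 hp2 n (n * δ)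
    have hm := measureReal_pi_le_sum_le F (U := fun x => -U x) hUm.neg ht0.le (r := K * t ^ 2)
      (by simpa using hm1) (by simpa using hm2) n (n * δ)
    have hexp : Real.exp (-t * (n * δ) + n * (K * t ^ 2)) ≤ Real.exp (-(t * δ / 2) * n) := by
      rw [Real.exp_le_exp]; nlinarith
    have hsub : {z : Fin n → E | ¬ |(∑ i, L (z i) ^ 2) / n - Q| ≤ δ * Q} ⊆
        {z | n * δ ≤ ∑ i, U (z i)} ∪ {z | n * δ ≤ ∑ i, -U (z i)} := by
      intro z hz
      by_contra hcon
      simp only [Set.mem_union, Set.mem_ofPred_eq, not_or, not_le] at hcon hz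
      have hsum : ∑ i, U (z i) = (∑ i, L (z i) ^ 2) / Q - n := by
        simp [hU, Finset.sum_sub_distrib, Finset.sum_div]
      rw [Finset.sum_neg_distrib, hsum] at hcon
      obtain ⟨h1, h2⟩ := hcon
      have e1 : (∑ i, L (z i) ^ 2) < (n * δ + n) * Q := by
        rw [← div_lt_iff₀ hpos]; linarith
      have e2 : (n - n * δ) * Q < (∑ i, L (z i) ^ 2) := by
        rw [← lt_div_iff₀ hpos]; linarith
      refine absurd hz (not_lt.2 (abs_le.2 ⟨?_, ?_⟩))
      · rw [neg_le_sub_iff_le_add, ← sub_le_iff_le_add, le_div_iff₀ hn0]; nlinarith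
      · rw [sub_le_iff_le_add, div_le_iff₀ hn0]; nlinarith
    refine (measure_mono hsub).trans ?_
    rw [← ofReal_measureReal]
    refine ENNReal.ofReal_le_ofReal ((measureReal_union_le _ _).trans ?_)
    linarith

end Persistence

/-! ### Risks as squared Hilbert norms, and existence of minimizers -/

namespace Persistence

/-- The linear predictor with coefficients `β`, as a linear functional of the observation. -/
noncomputable def predictor (m : ℕ) : (Fin m → ℝ) →ₗ[ℝ] StrongDual ℝ (Obs m) :=
  Fintype.linearCombination ℝ fun j =>
    (ContinuousLinearMap.proj j : (Fin m → ℝ) →L[ℝ] ℝ) ∘L ContinuousLinearMap.snd ℝ ℝ (Fin m → ℝ)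

/-- The residual `Y - ∑ j, β_j X_j`, as a linear functional of the observation. -/
noncomputable def residual (m : ℕ) (β : Fin m → ℝ) : StrongDual ℝ (Obs m) :=
  ContinuousLinearMap.fst ℝ ℝ (Fin m → ℝ) - predictor m β

theorem squaredLoss_eq (m : ℕ) (β : Fin m → ℝ) (z : Obs m) :
    squaredLoss m β z = residual m β z ^ 2 := by
  simp [squaredLoss, residual, predictor, Fintype.linearCombination_apply]

/-- The values of a functional on a sample, normalized so that the squared norm is the empirical
second moment. -/
noncomputable def sampleMap {E : Type*} [NormedAddCommGroup E] [NormedSpace ℝ E] {n : ℕ}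
    (z : Fin n → E) : StrongDual ℝ E →ₗ[ℝ] EuclideanSpace ℝ (Fin n) where
  toFun L := WithLp.toLp 2 fun i => (√n)⁻¹ * L (z i)
  map_add' L L' := by ext i; simp [mul_add]
  map_smul' a L := by ext i; simp; ring

theorem norm_sampleMap_sq {E : Type*} [NormedAddCommGroup E] [NormedSpace ℝ E] {n : ℕ}
    (z : Fin n → E) (L : StrongDual ℝ E) : ‖sampleMap z L‖ ^ 2 = (∑ i, L (z i) ^ 2) / n := by
  simp only [EuclideanSpace.norm_sq_eq, sampleMap, LinearMap.coe_mk, AddHom.coe_mk,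
    Real.norm_eq_abs, sq_abs, mul_pow, inv_pow, Real.sq_sqrt (Nat.cast_nonneg n),
    ← Finset.mul_sum]
  ring

theorem norm_toLpₗ_sq {E : Type*} [NormedAddCommGroup E] [NormedSpace ℝ E] [MeasurableSpace E]
    [BorelSpace E] [CompleteSpace E] [SecondCountableTopology E] (F : Measure E) [IsGaussian F]
    (L : StrongDual ℝ E) : ‖StrongDual.toLpₗ F 2 L‖ ^ 2 = ∫ x, L x ^ 2 ∂F := by
  have hid : MemLp id 2 F := IsGaussian.memLp_two_id
  rw [StrongDual.toLpₗ_apply hid, ← real_inner_self_eq_norm_sq, L2.inner_def]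
  refine integral_congr_ae ?_
  have hL : MemLp L 2 F := hid.continuousLinearMap_comp L
  filter_upwards [hL.coeFn_toLp] with x hx
  rw [hx]
  simp [sq]

theorem empiricalRisk_squaredLoss_eq {m n : ℕ} (z : Fin n → Obs m) (β : Fin m → ℝ) :
    empiricalRisk (squaredLoss m) z β = ‖sampleMap z (residual m β)‖ ^ 2 := by
  simp only [norm_sampleMap_sq, empiricalRisk, squaredLoss_eq]

theorem risk_squaredLoss_eq {m : ℕ} (F : Measure (Obs m)) [IsGaussian F] (β : Fin m → ℝ) :
    risk (squaredLoss m) F β = ‖StrongDual.toLpₗ F 2 (residual m β)‖ ^ 2 := by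
  simp only [norm_toLpₗ_sq, risk, squaredLoss_eq]

/-- A squared distance attains its minimum on a finite-dimensional subspace. -/
theorem exists_isArgMin_submodule {P H : Type*} [AddCommGroup P] [Module ℝ P]
    [NormedAddCommGroup H] [InnerProductSpace ℝ H] (T : P →ₗ[ℝ] H) (h : H) (W : Submodule ℝ P)
    [FiniteDimensional ℝ W] : ∃ b, IsArgMin (fun β => ‖h - T β‖ ^ 2) W b := by
  obtain ⟨_, ⟨b, hb, rfl⟩, hmin⟩ := (W.map T).exists_norm_eq_iInf_of_complete_subspace
    (Submodule.complete_of_finiteDimensional _) h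
  refine ⟨b, hb, fun β hβ => ?_⟩
  have hle := ciInf_le (f := fun w : W.map T => ‖h - w‖) ⟨0, by rintro _ ⟨w, rfl⟩; positivity⟩
    ⟨T β, Submodule.mem_map_of_mem hβ⟩
  have : ‖h - T b‖ ≤ ‖h - T β‖ := hmin.trans_le hle
  dsimp only
  gcongr

/-- A squared distance attains its minimum on the sparse vectors. -/
theorem exists_isArgMin_sparse {m : ℕ} (k : ℕ) {H : Type*}
    [NormedAddCommGroup H] [InnerProductSpace ℝ H] (T : (Fin m → ℝ) →ₗ[ℝ] H) (h : H) :
    ∃ b, IsArgMin (fun β => ‖h - T β‖ ^ 2) (sparse m k) b := by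
  classical
  -- The sparse set is a finite union of coordinate subspaces; the best of their minimizers is
  -- global.
  let W : Finset (Fin m) → Submodule ℝ (Fin m → ℝ) := fun S =>
    LinearMap.ker (LinearMap.pi fun j : {j // j ∉ S} => LinearMap.proj (j : Fin m))
  have hW : ∀ S β, β ∈ W S ↔ ∀ j, j ∉ S → β j = 0 := fun S β => by
    simp [W, LinearMap.mem_ker, funext_iff]
  choose b hb using fun S => exists_isArgMin_submodule T h (W S)
  obtain ⟨S, hS, hmin⟩ := (Finset.univ.filter fun S : Finset (Fin m) => S.card ≤ k).exists_min_image
    (fun S => ‖h - T (b S)‖ ^ 2) ⟨∅, by simp⟩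
  refine ⟨b S, ?_, fun β hβ => ?_⟩
  · refine (Finset.card_le_card fun j hj => ?_).trans (Finset.mem_filter.1 hS).2
    by_contra hjS
    exact (Finset.mem_filter.1 hj).2 ((hW _ _).1 (hb S).1 j hjS)
  · refine (hmin (Finset.univ.filter fun j => β j ≠ 0) 
      (Finset.mem_filter.2 ⟨Finset.mem_univ _, hβ⟩)).trans
      ((hb _).2 β ((hW _ _).2 fun j hj => ?_))
    simpa using hj

theorem exists_isArgMin_empiricalRisk {m n : ℕ} (k : ℕ) (z : Fin n → Obs m) :
    ∃ b, IsArgMin (empiricalRisk (squaredLoss m) z) (sparse m k) b := by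
  have h : empiricalRisk (squaredLoss m) z = fun β => ‖sampleMap z (ContinuousLinearMap.fst ℝ ℝ _) -
      (sampleMap z ∘ₗ predictor m) β‖ ^ 2 := by
    funext β
    rw [empiricalRisk_squaredLoss_eq, residual, map_sub, LinearMap.comp_apply]
  rw [h]
  exact exists_isArgMin_sparse k _ _

theorem exists_isArgMin_risk {m : ℕ} (k : ℕ) (F : Measure (Obs m)) [IsGaussian F] :
    ∃ b, IsArgMin (risk (squaredLoss m) F) (sparse m k) b := by
  have h : risk (squaredLoss m) F = fun β =>
      ‖StrongDual.toLpₗ F 2 (ContinuousLinearMap.fst ℝ ℝ (Fin m → ℝ)) -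
      (StrongDual.toLpₗ F 2 ∘ₗ predictor m) β‖ ^ 2 := by
    funext β
    rw [risk_squaredLoss_eq, residual, map_sub, LinearMap.comp_apply]
  rw [h]
  exact exists_isArgMin_sparse k _ _

end Persistence

/-! ### Union bound over supports, and its rate -/

namespace Persistence

/-- The span of the response and of the covariates selected by `f`. -/
def selectedSpan (m : ℕ) {k : ℕ} (f : Fin k → Option (Fin m)) :
    Submodule ℝ (StrongDual ℝ (Obs m)) :=
  Submodule.span ℝ (Set.range fun i : Option (Fin k) =>
    i.elim (ContinuousLinearMap.fst ℝ ℝ (Fin m → ℝ)) fun i =>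
      (f i).elim 0 fun j => predictor m (Pi.single j 1))

instance (m : ℕ) {k : ℕ} (f : Fin k → Option (Fin m)) :
    FiniteDimensional ℝ (selectedSpan m f) :=
  FiniteDimensional.span_of_finite ℝ (Set.finite_range _)

theorem finrank_selectedSpan_le (m : ℕ) {k : ℕ} (f : Fin k → Option (Fin m)) :
    Module.finrank ℝ (selectedSpan m f) ≤ k + 1 :=
  (finrank_range_le_card _).trans (by simp)

/-- Enumerate the support and pad with `none`, which selects the zero functional. Supports smaller
than `k` are thus covered, and there are `(m + 1) ^ k` selections. -/
theorem exists_residual_mem_selectedSpan {m k : ℕ} {β : Fin m → ℝ} (hβ : β ∈ sparse m k) :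
    ∃ f : Fin k → Option (Fin m), residual m β ∈ selectedSpan m f := by
  classical
  set S := Finset.univ.filter fun j => β j ≠ 0 with hS
  have hcard : S.card ≤ k := hβ
  refine ⟨fun i => if h : (i : ℕ) < S.card then some (S.equivFin.symm ⟨i, h⟩ : Fin m) else none, ?_⟩
  refine Submodule.sub_mem _ (Submodule.subset_span ⟨none, rfl⟩) ?_
  rw [pi_eq_sum_univ' β, map_sum]
  refine Submodule.sum_mem _ fun j _ => ?_
  rw [map_smul]
  by_cases hj : β j = 0
  · simp [hj]
  refine Submodule.smul_mem _ _ (Submodule.subset_span ?_)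
  have hjS : j ∈ S := by simp [hS, hj]
  have hlt := (S.equivFin ⟨j, hjS⟩).2
  refine ⟨some ⟨S.equivFin ⟨j, hjS⟩, hlt.trans_le hcard⟩, ?_⟩
  simp [hlt]

/-- With high probability the empirical risk is uniformly close to the risk on the sparse
predictors, relative to the risk. -/
theorem exists_forall_measure_abs_empiricalRisk_sub_risk_le {δ : ℝ} (hδ : 0 < δ) :
    ∃ c : ℝ, 0 < c ∧ ∀ (m k n : ℕ) (F : Measure (Obs m)) [IsGaussian F], 0 < n →
      (Measure.pi fun _ : Fin n => F)
        {z | ¬ ∀ β ∈ sparse m k, |empiricalRisk (squaredLoss m) z β - risk (squaredLoss m) F β| ≤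
          δ * risk (squaredLoss m) F β} ≤
      ENNReal.ofReal ((m + 1) ^ k * 6 ^ (k + 1) * (2 * Real.exp (-c * n))) := by
  classical
  obtain ⟨c, hc, hconc⟩ :=
    exists_forall_isGaussian_measure_abs_sum_sq_sub_le (δ := δ / 32) (by positivity)
  refine ⟨c, hc, fun m k n F _ hn => ?_⟩
  -- The test sets depend on `F` but not on the sample, as the union bound requires.
  choose N hNcard hN using fun f : Fin k → Option (Fin m) =>
    exists_test_finset (selectedSpan m f) (StrongDual.toLpₗ F 2)
  set bad : StrongDual ℝ (Obs m) → Set (Fin n → Obs m) := fun L =>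
    {z | ¬ |(∑ i, L (z i) ^ 2) / n - ∫ x, L x ^ 2 ∂F| ≤ δ / 32 * ∫ x, L x ^ 2 ∂F} with hbad
  have hsub : {z : Fin n → Obs m | ¬ ∀ β ∈ sparse m k,
      |empiricalRisk (squaredLoss m) z β - risk (squaredLoss m) F β| ≤
        δ * risk (squaredLoss m) F β} ⊆ ⋃ f, ⋃ L ∈ N f, bad L := by
    intro z hz
    by_contra hcon
    refine hz fun β hβ => ?_
    obtain ⟨f, hf⟩ := exists_residual_mem_selectedSpan hβ
    rw [empiricalRisk_squaredLoss_eq, risk_squaredLoss_eq]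
    have h := hN f (sampleMap z) (δ / 32) (fun L hL => ?_) _ hf
    · rwa [mul_div_cancel₀ _ (by norm_num : (32 : ℝ) ≠ 0)] at h
    · rw [norm_sampleMap_sq, norm_toLpₗ_sq]
      by_contra hL'
      exact hcon (Set.mem_iUnion.2 ⟨f, Set.mem_iUnion₂.2 ⟨L, hL, hL'⟩⟩)
  set p := ENNReal.ofReal (2 * Real.exp (-c * n)) with hp
  calc _ ≤ _ := measure_mono hsub
    _ ≤ ∑ f, (Measure.pi fun _ : Fin n => F) (⋃ L ∈ N f, bad L) := measure_iUnion_fintype_le _ _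
    _ ≤ ∑ f : Fin k → Option (Fin m), (6 : ℝ≥0∞) ^ (k + 1) * p := by
        refine Finset.sum_le_sum fun f _ => (measure_biUnion_finset_le _ _).trans ?_
        refine (Finset.sum_le_sum fun L _ => hconc F L n hn).trans ?_
        rw [Finset.sum_const, nsmul_eq_mul]
        gcongr
        have : (N f).card ≤ 6 ^ (k + 1) :=
          (hNcard f).trans (Nat.pow_le_pow_right (by norm_num) (finrank_selectedSpan_le m f))
        exact_mod_cast this
    _ = _ := by
        have h : ENNReal.ofReal ((m + 1) ^ k * 6 ^ (k + 1)) = (m + 1 : ℝ≥0∞) ^ k * 6 ^ (k + 1) := by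
          have : ((m : ℝ) + 1) ^ k * 6 ^ (k + 1) = (((m + 1) ^ k * 6 ^ (k + 1) : ℕ) : ℝ) := by
            push_cast; rfl
          rw [this, ENNReal.ofReal_natCast]
          push_cast; rfl
        rw [ENNReal.ofReal_mul (by positivity), h, Finset.sum_const, nsmul_eq_mul, ← mul_assoc]
        simp [hp]

/-- A minimizer of a relative approximation of the risk is nearly optimal. -/
theorem sub_le_of_isArgMin_of_abs_sub_le {P : Type*} {L L' : P → ℝ} {B : Set P} {b b' β₀ : P}
    {δ C : ℝ} (hδ : 0 < δ) (hδ2 : δ ≤ 1 / 2) (hb : IsArgMin L B b) (hb' : IsArgMin L' B b')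
    (hβ₀ : β₀ ∈ B) (hC : L β₀ ≤ C)
    (h : ∀ β ∈ B, |L' β - L β| ≤ δ * L β) : L b' - L b ≤ 4 * δ * C := by
  have h1 := abs_le.1 (h b hb.1)
  have h2 := abs_le.1 (h b' hb'.1)
  have h3 := hb'.2 b hb.1
  have h4 := (hb.2 β₀ hβ₀).trans hC
  have h6 := hb.2 b' hb'.1
  -- `(1 - δ) L b' ≤ L' b' ≤ L' b ≤ (1 + δ) L b` with `δ ≤ 1/2`. The excess is then at most `δ (L b
  -- + L b') ≤ 4 δ L b`.
  have h5 : L b' ≤ 3 * L b := by nlinarith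
  nlinarith

/-- The dimension may grow polynomially and the sparsity like `o(n / log n)`. -/
theorem tendsto_card_mul_exp {α : ℝ} (hα : 0 < α) {m k : ℕ → ℕ}
    (hm : (fun n => (m n : ℝ)) =O[atTop] fun n : ℕ => (n : ℝ) ^ α)
    (hk : (fun n => (k n : ℝ)) =o[atTop] fun n : ℕ => (n : ℝ) / Real.log n) {c : ℝ} (hc : 0 < c) :
    Tendsto (fun n => ((m n : ℝ) + 1) ^ k n * 6 ^ (k n + 1) * (2 * Real.exp (-c * n)))
      atTop (𝓝 0) := by
  obtain ⟨B, hB0, hB⟩ := hm.exists_pos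
  have hlim : Tendsto (fun n : ℕ => 12 * Real.exp (-(c / 2) * n)) atTop (𝓝 0) := by
    have h : Tendsto (fun n : ℕ => -(c / 2) * (n : ℝ)) atTop atBot :=
      tendsto_natCast_atTop_atTop.const_mul_atTop_of_neg (by linarith)
    simpa using (Real.tendsto_exp_atBot.comp h).const_mul 12
  refine squeeze_zero' (Eventually.of_forall fun n => by positivity) ?_ hlim
  -- With `6 (m + 1) ≤ n ^ (α + 1)`, this constant makes the counting factor at most `exp (c n /
  -- 2)`, half of the available decay.
  have hk' := hk.bound (show 0 < c / (2 * (α + 1)) by positivity)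
  filter_upwards [hB.bound, hk', eventually_ge_atTop 2,
    tendsto_natCast_atTop_atTop.eventually_ge_atTop (6 * (B + 1))] with n h1 h2 h3 h4
  have hn2 : (2 : ℝ) ≤ n := by exact_mod_cast h3
  have hn0 : (0 : ℝ) < n := by linarith
  have hlog : 0 < Real.log n := Real.log_pos (by linarith)
  rw [Real.norm_of_nonneg (by positivity), Real.norm_of_nonneg (by positivity)] at h1 h2
  have h5 : 6 * ((m n : ℝ) + 1) ≤ (n : ℝ) ^ (α + 1) := by
    have : 1 ≤ (n : ℝ) ^ α := Real.one_le_rpow (by linarith) hα.le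
    rw [Real.rpow_add_one hn0.ne']
    nlinarith
  have h6 : (6 * ((m n : ℝ) + 1)) ^ k n ≤ Real.exp (c / 2 * n) := by
    calc _ ≤ ((n : ℝ) ^ (α + 1)) ^ k n := by gcongr
      _ = Real.exp (k n * (Real.log n * (α + 1))) := by
          rw [Real.rpow_def_of_pos hn0, ← Real.exp_nat_mul]
      _ ≤ _ := by
          rw [Real.exp_le_exp]
          rw [div_mul_div_comm, le_div_iff₀ (by positivity)] at h2
          linarith
  calc _ = 12 * ((6 * ((m n : ℝ) + 1)) ^ k n * Real.exp (-c * n)) := by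
        rw [mul_pow, pow_succ]; ring
    _ ≤ 12 * (Real.exp (c / 2 * n) * Real.exp (-c * n)) := by gcongr
    _ = _ := by rw [← Real.exp_add]; congr 2; ring

end Persistence

/-! ### Persistence of best-subset selection -/

theorem mainTheorem5 (α : ℝ) (hα : 1 < α) (m k : ℕ → ℕ)
    (hm : (fun n => (m n : ℝ)) =Θ[atTop] fun n : ℕ => (n : ℝ) ^ α)
    (hk : (fun n => (k n : ℝ)) =o[atTop] fun n : ℕ => (n : ℝ) / Real.log n)
    (𝓕 : ∀ n, Set (Measure (Persistence.Obs (m n))))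
    (hGauss : ∀ n, ∀ F ∈ 𝓕 n, IsGaussian F)
    (hmoment : ∃ C : ℝ, ∀ n, ∀ F ∈ 𝓕 n,
      ∫ z, z.1 ^ 2 ∂F ≤ C ∧ ∀ j, ∫ z, z.2 j ^ 2 ∂F ≤ C) :
    (∀ n, ∀ z : Fin n → Persistence.Obs (m n), ∃ b,
      Persistence.IsArgMin (Persistence.empiricalRisk (Persistence.squaredLoss (m n)) z)
        (Persistence.sparse (m n) (k n)) b) ∧
    ∀ βhat : ∀ n, (Fin n → Persistence.Obs (m n)) → (Fin (m n) → ℝ),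
      (∀ n z, Persistence.IsArgMin
        (Persistence.empiricalRisk (Persistence.squaredLoss (m n)) z)
        (Persistence.sparse (m n) (k n)) (βhat n z)) →
      Persistence.IsPersistent (fun n => Persistence.squaredLoss (m n)) 𝓕
        (fun n => Persistence.sparse (m n) (k n)) βhat := by
  refine ⟨fun n z => Persistence.exists_isArgMin_empiricalRisk (k n) z, fun βhat hβ =>
    ⟨fun n z => (hβ n z).1, fun n F hF => ?_, fun βstar hstar ε hε => ?_⟩⟩
  · have := hGauss n F hF
    exact Persistence.exists_isArgMin_risk (k n) F
  obtain ⟨C, hC⟩ := hmoment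
  -- `|C| + 1` keeps the denominator positive: if every `𝓕 n` is empty, `C` may be negative.
  set δ := min (1 / 2) (ε / (4 * (|C| + 1))) with hδ
  have hδ0 : 0 < δ := by positivity
  have hδε : 4 * δ * |C| ≤ ε := by
    have : δ ≤ ε / (4 * (|C| + 1)) := min_le_right _ _
    rw [le_div_iff₀ (by positivity)] at this
    linarith
  obtain ⟨c, hc, hrip⟩ := Persistence.exists_forall_measure_abs_empiricalRisk_sub_risk_le hδ0
  have hlim := ENNReal.tendsto_ofReal
    (Persistence.tendsto_card_mul_exp (by linarith) hm.1 hk hc)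
  rw [ENNReal.ofReal_zero] at hlim
  refine tendsto_of_tendsto_of_tendsto_of_le_of_le' tendsto_const_nhds hlim
    (Eventually.of_forall fun n => zero_le) ?_
  filter_upwards [eventually_gt_atTop 0] with n hn
  refine iSup₂_le fun F hF => ?_
  have := hGauss n F hF
  refine (measure_mono fun z hz => ?_).trans (hrip (m n) (k n) n F hn)
  intro hz'
  refine absurd (Set.mem_ofPred_eq ▸ hz) (not_lt.2 ?_)
  refine (Persistence.sub_le_of_isArgMin_of_abs_sub_le (β₀ := 0) (C := |C|) hδ0 (min_le_left _ _)
    (hstar n F hF) (hβ n z) (by simp [Persistence.sparse]) ?_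
    hz').trans hδε
  refine le_trans ?_ (le_abs_self C)
  simpa [Persistence.risk, Persistence.squaredLoss] using (hC n F hF).1
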